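/- Let $Z$ be a finite set with at least four points. A function $\rho : Z\times Z\to[0,\infty)$ is called separating if it is symmetric and $\rho(\xi,\eta)=0$ if and only if $\xi=\eta$; a separating function is called antipodal if $\sup\rho=1$ and for every $\xi\in Z$ there is $\eta\in Z$ with $\rho(\xi,\eta)=1$. Two separating functions are Moebius equivalent if they have the same cross-ratios $\frac{\rho(\xi,\eta)\rho(\xi',\eta')}{\rho(\xi,\eta')\rho(\xi',\eta)}$ on all quadruples of distinct points $\xi,\xi',\eta,\eta'$; in that case there is a unique function $\frac{d\rho_2}{d\rho_1}: Z\to(0,\infty)$ with $\rho_2(\xi,\eta)^2=\frac{d\rho_2}{d\rho_1}(\xi)\,\frac{d\rho_2}{d\rho_1}(\eta)\,\rho_1(\xi,\eta)^2$ for all $\xi,\eta\in Z$. Let $\rho_0$ be an antipodal function on $Z$, and let $\mathcal M(Z,\rho_0)$ be the set of all antipodal functions on $Z$ that are Moebius equivalent to $\rho_0$, with the metric $d(\rho_1,\rho_2)=\left\|\log\frac{d\rho_2}{d\rho_1}\right\|_\infty$. A metric space $X$ is called injective if for every metric space $A$ and every $B\subseteq A$, each 1-Lipschitz map $B\to X$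 extends to a 1-Lipschitz map $A\to X$. For a metric space $S$, the injective hull (tight span) $E(S)$ is the set of all pointwise minimal elements of $\{f:S\to\mathbb R \mid f(x)+f(y)\ge d(x,y)\ \text{for all } x,y\in S\}$, with the metric $\|f-g\|_\infty$. Then: (1) Every closed ball (with any centre and any radius $r\ge 0$) in $\mathcal M(Z,\rho_0)$ is an injective metric space. (2) There is $R>0$ such that for every $r\ge R$ the sphere $S_r=\{\rho\in\mathcal M(Z,\rho_0) : d(\rho,\rho_0)=r\}$ has exactly $n=\#Z$ points, and the map $\rho\mapsto d(\cdot,\rho)|_{S_r}$ is an isometry from the closed ball $B(\rho_0,r)=\{\rho\in\mathcal M(Z,\rho_0) : d(\rho,\rho_0)\le r\}$ onto $E(S_r)$. -/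

import Mathlib

universe u v

/-! ### Separating functions, cross-ratios, antipodal functions on a finite set

The set `Z` is finite.  A finite metrizable space is discrete, so continuity of functions on `Z`
and on `Z × Z` is automatic and is not mentioned. -/

/-- A separating function on a finite set `Z` with at least four points. -/
structure IsSeparating {Z : Type*} [Fintype Z] (ρ : Z → Z → ℝ) : Prop where
  four_le_card : 4 ≤ Fintype.card Z
  nonneg : ∀ ξ η, 0 ≤ ρ ξ η
  symm : ∀ ξ η, ρ ξ η = ρ η ξ
  eq_zero_iff : ∀ ξ η, ρ ξ η = 0 ↔ ξ = η

/-- The cross-ratio `[ξ, ξ', η, η']` with respect to `ρ`. -/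
noncomputable def crossRatio {Z : Type*} (ρ : Z → Z → ℝ) (ξ ξ' η η' : Z) : ℝ :=
  (ρ ξ η * ρ ξ' η') / (ρ ξ η' * ρ ξ' η)

/-- Moebius equivalence: equal cross-ratios on all quadruples of distinct points. -/
def MoebiusEquiv {Z : Type*} (ρ₀ ρ₁ : Z → Z → ℝ) : Prop :=
  ∀ ξ ξ' η η' : Z, ξ ≠ ξ' → ξ ≠ η → ξ ≠ η' → ξ' ≠ η → ξ' ≠ η' → η ≠ η' →
    crossRatio ρ₀ ξ ξ' η η' = crossRatio ρ₁ ξ ξ' η η'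

/-- An antipodal function: a separating function of diameter one such that every point has a point
at distance one. -/
structure IsAntipodalFunction {Z : Type*} [Fintype Z] (ρ : Z → Z → ℝ) : Prop where
  separating : IsSeparating ρ
  diam_one : IsLUB (Set.range fun p : Z × Z => ρ p.1 p.2) 1
  antipodal : ∀ ξ, ∃ η, ρ ξ η = 1

/-! ### The derivative of one separating function with respect to another -/

/-- `φ` is a derivative of `ρ₁` with respect to `ρ₀`. -/
def IsMoebiusDerivative {Z : Type*} (ρ₁ ρ₀ : Z → Z → ℝ) (φ : Z → ℝ) : Prop :=
  (∀ ξ, 0 < φ ξ) ∧ ∀ ξ η, ρ₁ ξ η ^ 2 = φ ξ * φ η * ρ₀ ξ η ^ 2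

open Classical in
/-- The derivative `dρ₁/dρ₀`.  It exists and is unique for Moebius equivalent separating functions,
see `existsUnique_isMoebiusDerivative`; the value `1` in the other cases is never used. -/
noncomputable def moebiusDeriv {Z : Type*} (ρ₁ ρ₀ : Z → Z → ℝ) : Z → ℝ :=
  if h : ∃ φ, IsMoebiusDerivative ρ₁ ρ₀ φ then h.choose else 1

theorem exists_ne_ne {Z : Type*} [Fintype Z] (h : 4 ≤ Fintype.card Z) (a b : Z) :
    ∃ c, c ≠ a ∧ c ≠ b := by
  classical
  obtain ⟨c, -, hc⟩ := Finset.exists_mem_notMem_of_card_lt_card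
    (s := ({a, b} : Finset Z)) (t := Finset.univ)
    (lt_of_le_of_lt Finset.card_le_two (by rw [Finset.card_univ]; omega))
  exact ⟨c, by simpa using hc⟩

theorem IsSeparating.pos {Z : Type*} [Fintype Z] {ρ : Z → Z → ℝ} (h : IsSeparating ρ) {ξ η : Z}
    (hne : ξ ≠ η) : 0 < ρ ξ η :=
  lt_of_le_of_ne (h.nonneg _ _) fun h0 => hne ((h.eq_zero_iff _ _).1 h0.symm)

theorem IsMoebiusDerivative.unique {Z : Type*} [Fintype Z] {ρ₀ ρ₁ : Z → Z → ℝ}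
    (h₀ : IsSeparating ρ₀) {φ ψ : Z → ℝ} (hφ : IsMoebiusDerivative ρ₁ ρ₀ φ)
    (hψ : IsMoebiusDerivative ρ₁ ρ₀ ψ) : φ = ψ := by
  have key : ∀ a b, a ≠ b → φ a * φ b = ψ a * ψ b := fun a b hab =>
    mul_right_cancel₀ (pow_ne_zero 2 (h₀.pos hab).ne') ((hφ.2 a b).symm.trans (hψ.2 a b))
  funext a
  obtain ⟨b, hb, -⟩ := exists_ne_ne h₀.four_le_card a a
  obtain ⟨c, hca, hcb⟩ := exists_ne_ne h₀.four_le_card a b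
  have hab := key a b hb.symm
  have hac := key a c hca.symm
  have hbc := key b c hcb.symm
  have hsq : φ a ^ 2 * (φ b * φ c) = ψ a ^ 2 * (φ b * φ c) := by
    calc φ a ^ 2 * (φ b * φ c) = (φ a * φ b) * (φ a * φ c) := by ring
      _ = (ψ a * ψ b) * (ψ a * ψ c) := by rw [hab, hac]
      _ = ψ a ^ 2 * (ψ b * ψ c) := by ring
      _ = ψ a ^ 2 * (φ b * φ c) := by rw [hbc]
  have h2 := mul_right_cancel₀ (mul_pos (hφ.1 b) (hφ.1 c)).ne' hsq
  exact (pow_left_inj₀ (hφ.1 a).le (hψ.1 a).le two_ne_zero).1 h2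

theorem MoebiusEquiv.exists_isMoebiusDerivative {Z : Type*} [Fintype Z] {ρ₀ ρ₁ : Z → Z → ℝ}
    (h₀ : IsSeparating ρ₀) (h₁ : IsSeparating ρ₁) (h : MoebiusEquiv ρ₀ ρ₁) :
    ∃ φ, IsMoebiusDerivative ρ₁ ρ₀ φ := by
  set R : Z → Z → ℝ := fun a b => ρ₁ a b / ρ₀ a b with hR
  have Rpos : ∀ a b, a ≠ b → 0 < R a b := fun a b hab => div_pos (h₁.pos hab) (h₀.pos hab)
  have Rsymm : ∀ a b, R a b = R b a := fun a b => by simp only [hR, h₀.symm a b, h₁.symm a b]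
  have Rcr : ∀ a b c d, a ≠ b → a ≠ c → a ≠ d → b ≠ c → b ≠ d → c ≠ d →
      R a c * R b d = R a d * R b c := by
    intro a b c d hab hac had hbc hbd hcd
    have := h a b c d hab hac had hbc hbd hcd
    have p1 := h₀.pos hac
    have p2 := h₀.pos had
    have p3 := h₀.pos hbc
    have p4 := h₀.pos hbd
    have q2 := h₁.pos had
    have q3 := h₁.pos hbc
    simp only [crossRatio] at this
    simp only [hR]
    field_simp at this ⊢
    linarith
  set K : Z → Z → Z → ℝ := fun a b c => R a b * R a c / R b c with hK
  have Ksymm : ∀ a b c, K a b c = K a c b := fun a b c => by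
    simp only [hK, Rsymm b c, mul_comm]
  have Kstep : ∀ a b c d, a ≠ b → a ≠ c → a ≠ d → b ≠ c → b ≠ d → K a b c = K a b d := by
    intro a b c d hab hac had hbc hbd
    by_cases hcd : c = d
    · rw [hcd]
    · have := Rcr a b c d hab hac had hbc hbd hcd
      have p1 := Rpos b c hbc
      have p2 := Rpos b d hbd
      simp only [hK]
      rw [div_eq_div_iff p1.ne' p2.ne']
      linear_combination R a b * this
  have Kind : ∀ a b c d e, a ≠ b → a ≠ c → b ≠ c → a ≠ d → a ≠ e → d ≠ e → K a b c = K a d e := by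
    intro a b c d e hab hac hbc had hae hde
    by_cases hdc : d = c
    · subst hdc
      rw [Ksymm, Kstep a d b e hac hab hae hbc.symm hde]
    · rw [Ksymm, Kstep a c b d hac hab had hbc.symm (Ne.symm hdc), Ksymm,
        Kstep a d c e had hac hae hdc hde]
  have hex : ∀ a : Z, ∃ p : Z × Z, a ≠ p.1 ∧ a ≠ p.2 ∧ p.1 ≠ p.2 := by
    intro a
    obtain ⟨b, hb, -⟩ := exists_ne_ne h₀.four_le_card a a
    obtain ⟨c, hca, hcb⟩ := exists_ne_ne h₀.four_le_card a b
    exact ⟨(b, c), hb.symm, hca.symm, hcb.symm⟩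
  choose p hp using hex
  refine ⟨fun a => K a (p a).1 (p a).2, fun a => ?_, fun a b => ?_⟩
  · exact div_pos (mul_pos (Rpos _ _ (hp a).1) (Rpos _ _ (hp a).2.1)) (Rpos _ _ (hp a).2.2)
  · by_cases hab : a = b
    · subst hab
      rw [(h₁.eq_zero_iff a a).2 rfl, (h₀.eq_zero_iff a a).2 rfl]
      ring
    · obtain ⟨c, hca, hcb⟩ := exists_ne_ne h₀.four_le_card a b
      have e1 := Kind a _ _ b c (hp a).1 (hp a).2.1 (hp a).2.2 hab hca.symm hcb.symm
      have e2 := Kind b _ _ a c (hp b).1 (hp b).2.1 (hp b).2.2 (Ne.symm hab) hcb.symm hca.symm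
      have p1 := Rpos a c hca.symm
      have p2 := Rpos b c hcb.symm
      have e3 : K a b c * K b a c = R a b ^ 2 := by
        simp only [hK]
        rw [Rsymm b a]
        field_simp
      show _ = K a (p a).1 (p a).2 * K b (p b).1 (p b).2 * _
      rw [e1, e2, e3]
      have := h₀.pos hab
      simp only [hR]
      field_simp

/-- Existence and uniqueness of the derivative. -/
theorem existsUnique_isMoebiusDerivative {Z : Type*} [Fintype Z] {ρ₀ ρ₁ : Z → Z → ℝ}
    (h₀ : IsSeparating ρ₀) (h₁ : IsSeparating ρ₁) (h : MoebiusEquiv ρ₀ ρ₁) :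
    ∃! φ, IsMoebiusDerivative ρ₁ ρ₀ φ := by
  obtain ⟨φ, hφ⟩ := h.exists_isMoebiusDerivative h₀ h₁
  exact ⟨φ, hφ, fun ψ hψ => IsMoebiusDerivative.unique h₀ hψ hφ⟩

theorem moebiusDeriv_spec {Z : Type*} [Fintype Z] {ρ₀ ρ₁ : Z → Z → ℝ}
    (h₀ : IsSeparating ρ₀) (h₁ : IsSeparating ρ₁) (h : MoebiusEquiv ρ₀ ρ₁) :
    IsMoebiusDerivative ρ₁ ρ₀ (moebiusDeriv ρ₁ ρ₀) := by
  have hex := h.exists_isMoebiusDerivative h₀ h₁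
  rw [moebiusDeriv, dif_pos hex]
  exact hex.choose_spec

theorem moebiusDeriv_eq {Z : Type*} [Fintype Z] {ρ₀ ρ₁ : Z → Z → ℝ}
    (h₀ : IsSeparating ρ₀) {φ : Z → ℝ} (hφ : IsMoebiusDerivative ρ₁ ρ₀ φ) :
    moebiusDeriv ρ₁ ρ₀ = φ := by
  have hex : ∃ φ, IsMoebiusDerivative ρ₁ ρ₀ φ := ⟨φ, hφ⟩
  rw [moebiusDeriv, dif_pos hex]
  exact IsMoebiusDerivative.unique h₀ hex.choose_spec hφ

/-! ### The unrestricted Moebius space and the Moebius space -/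

/-- The unrestricted Moebius space: all separating functions Moebius equivalent to `ρ₀`. -/
def UnrestrictedMoebiusSpace {Z : Type*} [Fintype Z] (ρ₀ : Z → Z → ℝ) : Type _ :=
  {ρ : Z → Z → ℝ // IsSeparating ρ ∧ MoebiusEquiv ρ₀ ρ}

theorem UnrestrictedMoebiusSpace.equiv {Z : Type*} [Fintype Z] {ρ₀ : Z → Z → ℝ}
    (ρ₁ ρ₂ : UnrestrictedMoebiusSpace ρ₀) : MoebiusEquiv ρ₁.1 ρ₂.1 :=
  fun a b c d h1 h2 h3 h4 h5 h6 =>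
    (ρ₁.2.2 a b c d h1 h2 h3 h4 h5 h6).symm.trans (ρ₂.2.2 a b c d h1 h2 h3 h4 h5 h6)

theorem UnrestrictedMoebiusSpace.deriv_spec {Z : Type*} [Fintype Z] {ρ₀ : Z → Z → ℝ}
    (ρ₁ ρ₂ : UnrestrictedMoebiusSpace ρ₀) :
    IsMoebiusDerivative ρ₂.1 ρ₁.1 (moebiusDeriv ρ₂.1 ρ₁.1) :=
  moebiusDeriv_spec ρ₁.2.1 ρ₂.2.1 (ρ₁.equiv ρ₂)

/-- The metric `d(ρ₁, ρ₂) = ‖log (dρ₂/dρ₁)‖_∞` (the norm of `Z → ℝ` is the sup norm). -/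
noncomputable instance UnrestrictedMoebiusSpace.instMetricSpace {Z : Type*} [Fintype Z]
    (ρ₀ : Z → Z → ℝ) : MetricSpace (UnrestrictedMoebiusSpace ρ₀) where
  dist ρ₁ ρ₂ := ‖fun ξ => Real.log (moebiusDeriv ρ₂.1 ρ₁.1 ξ)‖
  dist_self ρ := by
    have : moebiusDeriv ρ.1 ρ.1 = fun _ => 1 :=
      moebiusDeriv_eq ρ.2.1 ⟨fun _ => one_pos, fun _ _ => by ring⟩
    show ‖fun ξ => Real.log (moebiusDeriv ρ.1 ρ.1 ξ)‖ = 0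
    rw [this]
    simp only [Real.log_one]
    exact norm_zero
  dist_comm ρ₁ ρ₂ := by
    have h := ρ₁.deriv_spec ρ₂
    have : moebiusDeriv ρ₁.1 ρ₂.1 = fun ξ => (moebiusDeriv ρ₂.1 ρ₁.1 ξ)⁻¹ := by
      refine moebiusDeriv_eq ρ₂.2.1 ⟨fun ξ => inv_pos.2 (h.1 ξ), fun ξ η => ?_⟩
      have p1 := h.1 ξ
      have p2 := h.1 η
      rw [h.2 ξ η]
      field_simp
    show ‖fun ξ => Real.log (moebiusDeriv ρ₂.1 ρ₁.1 ξ)‖ =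
      ‖fun ξ => Real.log (moebiusDeriv ρ₁.1 ρ₂.1 ξ)‖
    rw [this, ← norm_neg]
    congr 1
    funext ξ
    simp [Real.log_inv]
  dist_triangle ρ₁ ρ₂ ρ₃ := by
    have h := ρ₁.deriv_spec ρ₂
    have h' := ρ₂.deriv_spec ρ₃
    have : moebiusDeriv ρ₃.1 ρ₁.1 =
        fun ξ => moebiusDeriv ρ₂.1 ρ₁.1 ξ * moebiusDeriv ρ₃.1 ρ₂.1 ξ := by
      refine moebiusDeriv_eq ρ₁.2.1 ⟨fun ξ => mul_pos (h.1 ξ) (h'.1 ξ), fun ξ η => ?_⟩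
      rw [h'.2 ξ η, h.2 ξ η]
      ring
    show ‖fun ξ => Real.log (moebiusDeriv ρ₃.1 ρ₁.1 ξ)‖ ≤
      ‖fun ξ => Real.log (moebiusDeriv ρ₂.1 ρ₁.1 ξ)‖ +
      ‖fun ξ => Real.log (moebiusDeriv ρ₃.1 ρ₂.1 ξ)‖
    rw [this]
    refine le_trans (le_of_eq ?_) (norm_add_le _ _)
    congr 1
    funext ξ
    exact Real.log_mul (h.1 ξ).ne' (h'.1 ξ).ne'
  eq_of_dist_eq_zero {ρ₁ ρ₂} h0 := by
    have h := ρ₁.deriv_spec ρ₂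
    have h1 : ∀ ξ, moebiusDeriv ρ₂.1 ρ₁.1 ξ = 1 := fun ξ =>
      Real.eq_one_of_pos_of_log_eq_zero (h.1 ξ) (congrFun (norm_eq_zero.1 h0) ξ)
    apply Subtype.ext
    funext ξ η
    have := h.2 ξ η
    rw [h1, h1, one_mul, one_mul] at this
    exact ((pow_left_inj₀ (ρ₂.2.1.nonneg ξ η) (ρ₁.2.1.nonneg ξ η) two_ne_zero).1 this).symm

theorem UnrestrictedMoebiusSpace.dist_def {Z : Type*} [Fintype Z] {ρ₀ : Z → Z → ℝ}
    (ρ₁ ρ₂ : UnrestrictedMoebiusSpace ρ₀) :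
    dist ρ₁ ρ₂ = ‖fun ξ => Real.log (moebiusDeriv ρ₂.1 ρ₁.1 ξ)‖ := rfl

/-- The Moebius space of `ρ₀`: all antipodal functions Moebius equivalent to `ρ₀`,
with the metric of the unrestricted Moebius space. -/
abbrev MoebiusSpace {Z : Type*} [Fintype Z] (ρ₀ : Z → Z → ℝ) : Type _ :=
  {ρ : UnrestrictedMoebiusSpace ρ₀ // IsAntipodalFunction ρ.1}

/-- The antipodal function `ρ₀` as a point of its Moebius space. -/
def MoebiusSpace.base {Z : Type*} [Fintype Z] {ρ₀ : Z → Z → ℝ} (h : IsAntipodalFunction ρ₀) :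
    MoebiusSpace ρ₀ :=
  ⟨⟨ρ₀, h.separating, fun _ _ _ _ _ _ _ _ _ _ => rfl⟩, h⟩

/-! ### Injective metric spaces and the injective hull -/

/-- A metric space `X` is injective if every 1-Lipschitz map to `X` from a subspace of a metric
space has a 1-Lipschitz extension to the whole space. -/
def IsInjectiveMetricSpace (X : Type u) [MetricSpace X] : Prop :=
  ∀ (A : Type v) [MetricSpace A] (B : Set A) (f : B → X), LipschitzWith 1 f →
    ∃ F : A → X, LipschitzWith 1 F ∧ ∀ b : B, F b = f b

/-- The set `Δ(X)` of all `f` with `f x + f y ≥ d(x, y)`. -/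
def tightSpanDelta (X : Type*) [MetricSpace X] : Set (X → ℝ) :=
  {f | ∀ x y, dist x y ≤ f x + f y}

/-- The injective hull (tight span) `E(X)`: the pointwise minimal elements of `Δ(X)`. -/
def TightSpan (X : Type*) [MetricSpace X] : Type _ :=
  {f : X → ℝ // f ∈ tightSpanDelta X ∧ ∀ g ∈ tightSpanDelta X, (∀ x, g x ≤ f x) → g = f}

/-- Extremal functions are 1-Lipschitz. -/
theorem TightSpan.le_add_dist {X : Type*} [MetricSpace X] (f : TightSpan X) (x y : X) :
    f.1 x ≤ f.1 y + dist x y := by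
  classical
  by_contra! hlt
  have hf := f.2.1
  have hy : 0 ≤ f.1 y := by
    have := hf y y
    rw [dist_self] at this
    linarith
  have hg : Function.update f.1 x (f.1 y + dist x y) ∈ tightSpanDelta X := by
    intro a b
    by_cases ha : a = x <;> by_cases hb : b = x
    · rw [ha, hb, Function.update_self, dist_self]
      have := dist_nonneg (x := x) (y := y)
      linarith
    · subst ha
      rw [Function.update_self, Function.update_of_ne hb]
      have := hf y b
      have := dist_triangle a y b
      linarith
    · subst hb
      rw [Function.update_self, Function.update_of_ne ha]
      have := hf a y
      have := dist_triangle a y b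
      rw [dist_comm y b] at this
      linarith
    · rw [Function.update_of_ne ha, Function.update_of_ne hb]
      exact hf a b
  have hle : ∀ a, Function.update f.1 x (f.1 y + dist x y) a ≤ f.1 a := by
    intro a
    by_cases ha : a = x
    · subst ha
      rw [Function.update_self]
      exact hlt.le
    · rw [Function.update_of_ne ha]
  have := congrFun (f.2.2 _ hg hle) x
  rw [Function.update_self] at this
  linarith

theorem TightSpan.bddAbove {X : Type*} [MetricSpace X] (f g : TightSpan X) :
    BddAbove (Set.range fun x => |f.1 x - g.1 x|) := by
  rcases isEmpty_or_nonempty X with hX | ⟨⟨y⟩⟩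
  · rw [Set.range_eq_empty]
    exact bddAbove_empty
  · refine ⟨f.1 y + g.1 y, ?_⟩
    rintro _ ⟨x, rfl⟩
    have h1 := f.le_add_dist x y
    have h2 := g.le_add_dist x y
    have h3 := f.2.1 x y
    have h4 := g.2.1 x y
    exact abs_le.2 ⟨by linarith, by linarith⟩

/-- The metric `‖f - g‖_∞` on `E(X)`; the supremum is finite by `TightSpan.bddAbove`. -/
noncomputable instance TightSpan.instMetricSpace (X : Type*) [MetricSpace X] :
    MetricSpace (TightSpan X) where
  dist f g := ⨆ x, |f.1 x - g.1 x|
  dist_self f := by simp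
  dist_comm f g := by simp only [abs_sub_comm]
  dist_triangle f g h := by
    show (⨆ x, |f.1 x - h.1 x|) ≤ (⨆ x, |f.1 x - g.1 x|) + ⨆ x, |g.1 x - h.1 x|
    rcases isEmpty_or_nonempty X with hX | hX
    · simp
    · refine ciSup_le fun x => (abs_sub_le _ (g.1 x) _).trans ?_
      exact add_le_add (le_ciSup (TightSpan.bddAbove f g) x) (le_ciSup (TightSpan.bddAbove g h) x)
  eq_of_dist_eq_zero {f g} h0 := by
    apply Subtype.ext
    funext x
    have h1 : |f.1 x - g.1 x| ≤ 0 := h0 ▸ le_ciSup (TightSpan.bddAbove f g) x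
    exact sub_eq_zero.1 (abs_eq_zero.1 (le_antisymm h1 (abs_nonneg _)))

theorem TightSpan.dist_def {X : Type*} [MetricSpace X] (f g : TightSpan X) :
    dist f g = ⨆ x, |f.1 x - g.1 x| := rfl

/-!
Taking `f = -log (dρ/dρ₀)` as coordinates turns the Moebius space of `ρ₀` isometrically into a
subset of `Z → ℝ` with the sup norm. With `c ξ η = 2 log ρ₀(ξ, η)`, it is the set of all `f` such
that `f ξ + f η ≥ c ξ η` whenever `ξ ≠ η`, and such that for each `ξ` equality holds for some
`η ≠ ξ` (`MoebiusSpace.isometry_coord`, `MoebiusSpace.coord_mem`, `MoebiusSpace.exists_coord_eq`).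
This is a tight span without the diagonal constraints `f ξ ≥ 0`.

Balls are injective: lowering the coordinates of `f` one after the other as far as the inequalities
permit is a `1`-Lipschitz retraction onto this set (`exists_retraction_offDiagHull`), and the upper
McShane extension, cut off at `centre + r`, extends a map into a ball so that the inequalities
survive (`exists_lipschitz_extension_mem_offDiagDelta`).

For large `r`, a point of the sphere of radius `r` about `0` has a coordinate `-r`, which forces
all other coordinates, so the sphere consists of one point `v ξ` for each `ξ`
(`eq_spherePoint_of_norm_eq`). Points `f` of the ball have distance `f ξ + r` to `v ξ`
(`dist_spherePoint`), so that `f ↦ d(·, f)` is the shift `f ↦ f + r`. The shift turns the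
inequalities for `f` into those that define the tight span of the sphere; the diagonal constraints
of the latter become `f ξ ≥ -r`.
-/

/-! ### The off-diagonal tight span -/

/-- The functions `f` with `c ξ η ≤ f ξ + f η` for all `ξ ≠ η`. The values of `c` on the diagonal
play no role. -/
def offDiagDelta {Z : Type*} (c : Z → Z → ℝ) : Set (Z → ℝ) :=
  {f | ∀ ξ η, ξ ≠ η → c ξ η ≤ f ξ + f η}

/-- The functions in `offDiagDelta c` for which each `ξ` has some `η ≠ ξ` with
`f ξ + f η = c ξ η`; for finite `Z` with two points or more these are its minimal elements. -/
def offDiagHull {Z : Type*} (c : Z → Z → ℝ) : Set (Z → ℝ) :=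
  {f | f ∈ offDiagDelta c ∧ ∀ ξ, ∃ η, η ≠ ξ ∧ f ξ + f η = c ξ η}

/-- The smallest value at `ξ` permitted by the off-diagonal inequalities when the other values are
those of `f`. -/
noncomputable def offDiagConj {Z : Type*} (c : Z → Z → ℝ) (f : Z → ℝ) (ξ : Z) : ℝ :=
  ⨆ η : {η // η ≠ ξ}, (c ξ η - f η)

theorem le_offDiagConj {Z : Type*} [Finite Z] (c : Z → Z → ℝ) (f : Z → ℝ) {ξ η : Z}
    (h : η ≠ ξ) : c ξ η - f η ≤ offDiagConj c f ξ :=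
  le_ciSup (f := fun η : {η // η ≠ ξ} => c ξ η - f η) (Set.finite_range _).bddAbove ⟨η, h⟩

theorem exists_eq_offDiagConj {Z : Type*} [Finite Z] [Nontrivial Z] (c : Z → Z → ℝ) (f : Z → ℝ)
    (ξ : Z) : ∃ η, η ≠ ξ ∧ c ξ η - f η = offDiagConj c f ξ := by
  obtain ⟨η, hη⟩ := exists_ne ξ
  have : Nonempty {η // η ≠ ξ} := ⟨⟨η, hη⟩⟩
  obtain ⟨⟨ζ, hζ⟩, h⟩ := exists_eq_ciSup_of_finite (f := fun η : {η // η ≠ ξ} => c ξ η - f η)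
  exact ⟨ζ, hζ, h⟩

theorem offDiagConj_le {Z : Type*} [Finite Z] [Nontrivial Z] {c : Z → Z → ℝ} {f : Z → ℝ}
    (hf : f ∈ offDiagDelta c) (ξ : Z) : offDiagConj c f ξ ≤ f ξ := by
  obtain ⟨η, hη, h⟩ := exists_eq_offDiagConj c f ξ
  have := hf ξ η hη.symm
  linarith

theorem offDiagConj_eq {Z : Type*} [Finite Z] [Nontrivial Z] {c : Z → Z → ℝ} {f : Z → ℝ}
    (hf : f ∈ offDiagHull c) (ξ : Z) : offDiagConj c f ξ = f ξ := by
  obtain ⟨η, hη, h⟩ := hf.2 ξ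
  have := le_offDiagConj c f hη
  exact le_antisymm (offDiagConj_le hf.1 ξ) (by linarith)

theorem offDiagConj_le_add_dist {Z : Type*} [Fintype Z] [Nontrivial Z] (c : Z → Z → ℝ)
    (f g : Z → ℝ) (ξ : Z) : offDiagConj c f ξ ≤ offDiagConj c g ξ + dist f g := by
  obtain ⟨η, hη, h⟩ := exists_eq_offDiagConj c f ξ
  have h1 := le_offDiagConj c g hη
  have h2 := abs_le.1 ((Real.dist_eq _ _).symm.le.trans (dist_le_pi_dist f g η))
  linarith [h2.1]

/-- Lowering a function in `offDiagDelta c` keeps equality at `ξ` as long as the function remains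
in `offDiagDelta c`. -/
theorem offDiag_attained_of_le {Z : Type*} {c : Z → Z → ℝ} {f g : Z → ℝ}
    (hg : g ∈ offDiagDelta c) (hle : g ≤ f) {ξ : Z}
    (h : ∃ η, η ≠ ξ ∧ f ξ + f η = c ξ η) : ∃ η, η ≠ ξ ∧ g ξ + g η = c ξ η := by
  obtain ⟨η, hη, h⟩ := h
  have h1 := hg ξ η hη.symm
  have h2 := hle ξ
  have h3 := hle η
  exact ⟨η, hη, by linarith⟩

section
open Classical in
/-- Lower the value at `ξ` as far as the off-diagonal inequalities permit. -/
noncomputable def lowerAt {Z : Type*} (c : Z → Z → ℝ) (ξ : Z) (f : Z → ℝ) : Z → ℝ :=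
  Function.update f ξ (offDiagConj c f ξ)
end

theorem lowerAt_self {Z : Type*} (c : Z → Z → ℝ) (ξ : Z) (f : Z → ℝ) :
    lowerAt c ξ f ξ = offDiagConj c f ξ := by
  simp [lowerAt]

theorem lowerAt_of_ne {Z : Type*} (c : Z → Z → ℝ) {ξ η : Z} (h : η ≠ ξ) (f : Z → ℝ) :
    lowerAt c ξ f η = f η := by
  simp [lowerAt, h]

theorem lowerAt_mem {Z : Type*} [Finite Z] {c : Z → Z → ℝ} (hc : ∀ ξ η, c ξ η = c η ξ) (ξ : Z)
    {f : Z → ℝ} (hf : f ∈ offDiagDelta c) : lowerAt c ξ f ∈ offDiagDelta c := by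
  intro a b hab
  by_cases ha : a = ξ
  · subst ha
    rw [lowerAt_self, lowerAt_of_ne c hab.symm]
    have := le_offDiagConj c f hab.symm
    linarith
  · rw [lowerAt_of_ne c ha]
    by_cases hb : b = ξ
    · subst hb
      rw [lowerAt_self, hc]
      have := le_offDiagConj c f ha
      linarith
    · rw [lowerAt_of_ne c hb]
      exact hf a b hab

theorem lowerAt_le {Z : Type*} [Finite Z] [Nontrivial Z] {c : Z → Z → ℝ} (ξ : Z) {f : Z → ℝ}
    (hf : f ∈ offDiagDelta c) : lowerAt c ξ f ≤ f := by
  intro a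
  by_cases ha : a = ξ
  · subst ha
    rw [lowerAt_self]
    exact offDiagConj_le hf a
  · rw [lowerAt_of_ne c ha]

theorem lowerAt_attained {Z : Type*} [Finite Z] [Nontrivial Z] (c : Z → Z → ℝ) (ξ : Z)
    (f : Z → ℝ) : ∃ η, η ≠ ξ ∧ lowerAt c ξ f ξ + lowerAt c ξ f η = c ξ η := by
  obtain ⟨η, hη, h⟩ := exists_eq_offDiagConj c f ξ
  exact ⟨η, hη, by rw [lowerAt_self, lowerAt_of_ne c hη]; linarith⟩

theorem lowerAt_eq_self {Z : Type*} [Finite Z] [Nontrivial Z] {c : Z → Z → ℝ} (ξ : Z)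
    {f : Z → ℝ} (hf : f ∈ offDiagHull c) : lowerAt c ξ f = f := by
  classical
  rw [lowerAt, offDiagConj_eq hf, Function.update_eq_self]

theorem lipschitzWith_lowerAt {Z : Type*} [Fintype Z] [Nontrivial Z] (c : Z → Z → ℝ) (ξ : Z) :
    LipschitzWith 1 (lowerAt c ξ) := by
  refine LipschitzWith.of_dist_le_mul fun f g => ?_
  rw [NNReal.coe_one, one_mul]
  refine (dist_pi_le_iff dist_nonneg).2 fun a => ?_
  by_cases ha : a = ξ
  · subst ha
    rw [lowerAt_self, lowerAt_self, Real.dist_eq]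
    have h1 := offDiagConj_le_add_dist c f g a
    have h2 := offDiagConj_le_add_dist c g f a
    rw [dist_comm g f] at h2
    exact abs_le.2 ⟨by linarith, by linarith⟩
  · rw [lowerAt_of_ne c ha, lowerAt_of_ne c ha]
    exact dist_le_pi_dist f g a

/-- The composition of the maps `lowerAt c ξ` over all `ξ`, in any order, is a `1`-Lipschitz
retraction of `offDiagDelta c` onto `offDiagHull c`: an equality once attained persists under the
later steps. -/
theorem exists_retraction_offDiagHull {Z : Type*} [Fintype Z] [Nontrivial Z] {c : Z → Z → ℝ}
    (hc : ∀ ξ η, c ξ η = c η ξ) :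
    ∃ p : (Z → ℝ) → (Z → ℝ), (∀ f ∈ offDiagDelta c, p f ∈ offDiagHull c) ∧
      (∀ f ∈ offDiagHull c, p f = f) ∧ LipschitzWith 1 p := by
  classical
  suffices H : ∀ s : Finset Z, ∃ p : (Z → ℝ) → (Z → ℝ),
      (∀ f ∈ offDiagDelta c, p f ∈ offDiagDelta c) ∧
      (∀ f ∈ offDiagDelta c, ∀ ξ ∈ s, ∃ η, η ≠ ξ ∧ p f ξ + p f η = c ξ η) ∧
      (∀ f ∈ offDiagHull c, p f = f) ∧ LipschitzWith 1 p by
    obtain ⟨p, h1, h2, h3, h4⟩ := H Finset.univ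
    exact ⟨p, fun f hf => ⟨h1 f hf, fun ξ => h2 f hf ξ (Finset.mem_univ ξ)⟩, h3, h4⟩
  intro s
  induction s using Finset.induction_on with
  | empty =>
    exact ⟨id, fun f hf => hf, fun f _ ξ hξ => absurd hξ (Finset.notMem_empty ξ), fun f _ => rfl,
      LipschitzWith.id⟩
  | insert a s _ ih =>
    obtain ⟨p, h1, h2, h3, h4⟩ := ih
    refine ⟨lowerAt c a ∘ p, fun f hf => lowerAt_mem hc a (h1 f hf), fun f hf ξ hξ => ?_,
      fun f hf => ?_, ?_⟩
    · rcases Finset.mem_insert.1 hξ with rfl | hξ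
      · exact lowerAt_attained c ξ (p f)
      · exact offDiag_attained_of_le (lowerAt_mem hc a (h1 f hf)) (lowerAt_le a (h1 f hf))
          (h2 f hf ξ hξ)
    · rw [Function.comp_apply, h3 f hf, lowerAt_eq_self a hf]
    · simpa using (lipschitzWith_lowerAt c a).comp h4

/-! ### Extension of maps into balls of the off-diagonal tight span -/

/-- A `1`-Lipschitz map from `B` to a ball with centre `g` in `offDiagDelta c` extends to a
`1`-Lipschitz map to the ball of the same radius in `offDiagDelta c`. -/
theorem exists_lipschitz_extension_mem_offDiagDelta {Z : Type*} [Fintype Z] {c : Z → Z → ℝ}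
    {A : Type*} [MetricSpace A] {B : Set A} {g : Z → ℝ} (hg : g ∈ offDiagDelta c) {r : ℝ}
    (hr : 0 ≤ r) {f : B → Z → ℝ} (hf : LipschitzWith 1 f) (hfc : ∀ b, f b ∈ offDiagDelta c)
    (hfr : ∀ b, dist (f b) g ≤ r) :
    ∃ F : A → Z → ℝ, LipschitzWith 1 F ∧ (∀ b : B, F b = f b) ∧
      ∀ a, F a ∈ offDiagDelta c ∧ dist (F a) g ≤ r := by
  rcases isEmpty_or_nonempty B with hB | hB
  · exact ⟨fun _ => g, LipschitzWith.const' g, fun b => hB.elim b,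
      fun _ => ⟨hg, by rwa [dist_self]⟩⟩
  have hf' : ∀ b b' ξ, f b ξ ≤ f b' ξ + dist b b' := fun b b' ξ => by
    have h1 := (dist_le_pi_dist (f b) (f b') ξ).trans (hf.dist_le_mul b b')
    rw [NNReal.coe_one, one_mul, Real.dist_eq] at h1
    linarith [(abs_le.1 h1).2]
  have hlo : ∀ b ξ, g ξ - r ≤ f b ξ ∧ f b ξ ≤ g ξ + r := fun b ξ => by
    have h1 := (dist_le_pi_dist (f b) g ξ).trans (hfr b)
    rw [Real.dist_eq] at h1
    have := abs_le.1 h1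
    exact ⟨by linarith [this.1], by linarith [this.2]⟩
  set G : A → Z → ℝ := fun a ξ => ⨅ b : B, (f b ξ + dist a b) with hG
  have hbdd : ∀ (a : A) ξ, BddBelow (Set.range fun b : B => f b ξ + dist a b) := fun a ξ => by
    refine ⟨g ξ - r, ?_⟩
    rintro _ ⟨b, rfl⟩
    have := (hlo b ξ).1
    have := dist_nonneg (x := a) (y := (b : A))
    show _ ≤ f b ξ + dist a b
    linarith
  have hGle : ∀ (a : A) ξ (b : B), G a ξ ≤ f b ξ + dist a b := fun a ξ b => ciInf_le (hbdd a ξ) b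
  have hGlo : ∀ (a : A) ξ, g ξ - r ≤ G a ξ := fun a ξ => le_ciInf fun b => by
    have := (hlo b ξ).1
    have := dist_nonneg (x := a) (y := (b : A))
    linarith
  have hGlip : ∀ (a a' : A) ξ, G a ξ ≤ G a' ξ + dist a a' := fun a a' ξ => by
    suffices G a ξ - dist a a' ≤ G a' ξ by linarith
    refine le_ciInf fun b => ?_
    have := hGle a ξ b
    have := dist_triangle a a' b
    linarith
  have hGc : ∀ (a : A) ξ η, ξ ≠ η → c ξ η ≤ G a ξ + G a η := fun a ξ η hne => by
    suffices c ξ η - G a η ≤ G a ξ by linarith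
    refine le_ciInf fun b => ?_
    suffices c ξ η - (f b ξ + dist a b) ≤ G a η by linarith
    refine le_ciInf fun b' => ?_
    have h1 := hfc b ξ η hne
    have h2 := hf' b b' η
    have h3 := dist_triangle_left (b : A) b' a
    rw [Subtype.dist_eq] at h2
    linarith
  refine ⟨fun a ξ => min (G a ξ) (g ξ + r), ?_, fun b => ?_, fun a => ⟨fun ξ η hne => ?_, ?_⟩⟩
  · refine LipschitzWith.of_dist_le_mul fun a a' => ?_
    rw [NNReal.coe_one, one_mul]
    refine (dist_pi_le_iff dist_nonneg).2 fun ξ => ?_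
    have h1 := hGlip a a' ξ
    have h2 := hGlip a' a ξ
    rw [dist_comm a' a] at h2
    rw [Real.dist_eq]
    refine (abs_min_sub_min_le_max _ _ _ _).trans (max_le (abs_le.2 ⟨?_, ?_⟩) ?_)
    · linarith
    · linarith
    · rw [sub_self, abs_zero]
      exact dist_nonneg
  · funext ξ
    have h1 : G b ξ = f b ξ := by
      refine le_antisymm (by simpa using hGle b ξ b) (le_ciInf fun b' => ?_)
      exact hf' b b' ξ
    show min (G b ξ) (g ξ + r) = f b ξ
    rw [h1]
    exact min_eq_left (hlo b ξ).2
  · have h1 := hGc a ξ η hne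
    have h2 := hg ξ η hne
    have h3 := hGlo a ξ
    have h4 := hGlo a η
    show c ξ η ≤ min (G a ξ) (g ξ + r) + min (G a η) (g η + r)
    rcases min_choice (G a ξ) (g ξ + r) with e1 | e1 <;>
      rcases min_choice (G a η) (g η + r) with e2 | e2 <;> rw [e1, e2] <;> linarith
  · refine (dist_pi_le_iff hr).2 fun ξ => ?_
    have h1 := hGlo a ξ
    have h2 := min_le_right (G a ξ) (g ξ + r)
    have h3 : g ξ - r ≤ min (G a ξ) (g ξ + r) := le_min h1 (by linarith)
    rw [Real.dist_eq]
    exact abs_le.2 ⟨by linarith, by linarith⟩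

/-- The extension property of balls of `offDiagHull c`. -/
theorem exists_lipschitz_extension_mem_offDiagHull {Z : Type*} [Fintype Z] [Nontrivial Z]
    {c : Z → Z → ℝ} (hc : ∀ ξ η, c ξ η = c η ξ)
    {A : Type*} [MetricSpace A] {B : Set A} {g : Z → ℝ} (hg : g ∈ offDiagHull c) {r : ℝ}
    (hr : 0 ≤ r) {f : B → Z → ℝ} (hf : LipschitzWith 1 f) (hfc : ∀ b, f b ∈ offDiagHull c)
    (hfr : ∀ b, dist (f b) g ≤ r) :
    ∃ F : A → Z → ℝ, LipschitzWith 1 F ∧ (∀ b : B, F b = f b) ∧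
      ∀ a, F a ∈ offDiagHull c ∧ dist (F a) g ≤ r := by
  obtain ⟨p, hp1, hp2, hp3⟩ := exists_retraction_offDiagHull hc
  obtain ⟨F, hF1, hF2, hF3⟩ := exists_lipschitz_extension_mem_offDiagDelta hg.1 hr hf
    (fun b => (hfc b).1) hfr
  refine ⟨p ∘ F, by simpa using hp3.comp hF1, fun b => ?_, fun a => ⟨hp1 _ (hF3 a).1, ?_⟩⟩
  · rw [Function.comp_apply, hF2, hp2 _ (hfc b)]
  · have h := hp3.dist_le_mul (F a) g
    rw [hp2 g hg, NNReal.coe_one, one_mul] at h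
    exact h.trans (hF3 a).2

/-! ### Large spheres in the off-diagonal tight span -/

section
open Classical in
/-- The function with value `-r` at `ξ` and the smallest values `c ξ η + r` elsewhere that the
off-diagonal inequalities with `ξ` permit. -/
noncomputable def spherePoint {Z : Type*} (c : Z → Z → ℝ) (r : ℝ) (ξ : Z) : Z → ℝ :=
  fun η => if η = ξ then -r else c ξ η + r
end

theorem spherePoint_self {Z : Type*} (c : Z → Z → ℝ) (r : ℝ) (ξ : Z) :
    spherePoint c r ξ ξ = -r := by
  simp [spherePoint]

theorem spherePoint_of_ne {Z : Type*} (c : Z → Z → ℝ) (r : ℝ) {ξ η : Z} (h : η ≠ ξ) :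
    spherePoint c r ξ η = c ξ η + r := by
  simp [spherePoint, h]

theorem spherePoint_mem {Z : Type*} [Nontrivial Z] {c : Z → Z → ℝ} {r : ℝ}
    (hc : ∀ ξ η, c ξ η = c η ξ) (hc0 : ∀ ξ η, c ξ η ≤ 0) (hcr : ∀ ξ η, -r < c ξ η) (ξ : Z) :
    spherePoint c r ξ ∈ offDiagHull c := by
  refine ⟨fun a b hab => ?_, fun a => ?_⟩
  · by_cases ha : a = ξ
    · subst ha
      rw [spherePoint_self, spherePoint_of_ne c r hab.symm]
      linarith
    · rw [spherePoint_of_ne c r ha]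
      by_cases hb : b = ξ
      · subst hb
        rw [spherePoint_self, hc a b]
        linarith
      · rw [spherePoint_of_ne c r hb]
        have := hc0 a b
        have := hcr ξ a
        have := hcr ξ b
        linarith
  · by_cases ha : a = ξ
    · subst ha
      obtain ⟨b, hb⟩ := exists_ne a
      refine ⟨b, hb, ?_⟩
      rw [spherePoint_self, spherePoint_of_ne c r hb]
      ring
    · refine ⟨ξ, Ne.symm ha, ?_⟩
      rw [spherePoint_self, spherePoint_of_ne c r ha, hc a ξ]
      ring

theorem norm_spherePoint {Z : Type*} [Fintype Z] {c : Z → Z → ℝ} {r : ℝ} (hr : 0 ≤ r)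
    (hc0 : ∀ ξ η, c ξ η ≤ 0) (hcr : ∀ ξ η, -r < c ξ η) (ξ : Z) : ‖spherePoint c r ξ‖ = r := by
  refine le_antisymm ((pi_norm_le_iff_of_nonneg hr).2 fun η => ?_) ?_
  · by_cases h : η = ξ
    · subst h
      rw [spherePoint_self, Real.norm_eq_abs, abs_neg, abs_of_nonneg hr]
    · rw [spherePoint_of_ne c r h, Real.norm_eq_abs]
      have := hc0 ξ η
      have := hcr ξ η
      exact abs_le.2 ⟨by linarith, by linarith⟩
  · have := norm_le_pi_norm (spherePoint c r ξ) ξ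
    rwa [spherePoint_self, Real.norm_eq_abs, abs_neg, abs_of_nonneg hr] at this

theorem spherePoint_injective {Z : Type*} {c : Z → Z → ℝ} {r : ℝ} (hr : 0 ≤ r)
    (hcr : ∀ ξ η, -r < c ξ η) : Function.Injective (spherePoint c r) := by
  intro ξ η h
  by_contra hne
  have h1 := congrFun h ξ
  rw [spherePoint_self, spherePoint_of_ne c r hne] at h1
  have := hcr η ξ
  linarith

/-- A point of `offDiagHull c` of norm `r` is one of the points `spherePoint c r ξ`. If `r` is
attained as a value then `-r` is attained too, because `c ≤ 0`; and a value `-r` at `ξ` makes all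
other values positive, so that only the inequalities with `ξ` can be equalities. -/
theorem eq_spherePoint_of_norm_eq {Z : Type*} [Fintype Z] {c : Z → Z → ℝ} {r : ℝ} (hr : 0 < r)
    (hc : ∀ ξ η, c ξ η = c η ξ) (hc0 : ∀ ξ η, c ξ η ≤ 0) (hcr : ∀ ξ η, -r < c ξ η)
    {f : Z → ℝ} (hf : f ∈ offDiagHull c) (hfr : ‖f‖ = r) : ∃ ξ, spherePoint c r ξ = f := by
  have hle : ∀ a, -r ≤ f a ∧ f a ≤ r := fun a =>
    abs_le.1 ((norm_le_pi_norm f a).trans hfr.le)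
  obtain ⟨ξ, hξ⟩ : ∃ ξ, f ξ = -r := by
    obtain ⟨a, ha⟩ : ∃ a, r ≤ |f a| := by
      by_contra! hlt
      exact (((pi_norm_lt_iff hr).2 hlt).trans_eq hfr.symm).false
    rcases le_abs.1 ha with h | h
    · obtain ⟨b, -, hb⟩ := hf.2 a
      have := hc0 a b
      exact ⟨b, le_antisymm (by linarith) (hle b).1⟩
    · exact ⟨a, le_antisymm (by linarith) (hle a).1⟩
  have hpos : ∀ a, a ≠ ξ → 0 < f a := fun a ha => by
    have := hf.1 a ξ ha
    have := hcr a ξ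
    linarith
  refine ⟨ξ, funext fun a => ?_⟩
  by_cases ha : a = ξ
  · subst ha
    rw [spherePoint_self, hξ]
  · rw [spherePoint_of_ne c r ha]
    obtain ⟨b, hb, hab⟩ := hf.2 a
    by_cases hbξ : b = ξ
    · subst hbξ
      rw [hc b a]
      linarith
    · have := hpos a ha
      have := hpos b hbξ
      have := hc0 a b
      linarith

theorem dist_spherePoint {Z : Type*} [Fintype Z] {c : Z → Z → ℝ} {r : ℝ}
    (hc : ∀ ξ η, c ξ η = c η ξ) (hc0 : ∀ ξ η, c ξ η ≤ 0) (hcr : ∀ ξ η, -r < c ξ η)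
    {f : Z → ℝ} (hf : f ∈ offDiagHull c) (hfr : ‖f‖ ≤ r) (ξ : Z) :
    dist (spherePoint c r ξ) f = f ξ + r := by
  have hle : ∀ a, -r ≤ f a ∧ f a ≤ r := fun a =>
    abs_le.1 ((norm_le_pi_norm f a).trans hfr)
  have hnn : 0 ≤ f ξ + r := by linarith [(hle ξ).1]
  refine le_antisymm ((dist_pi_le_iff hnn).2 fun η => ?_) ?_
  · by_cases h : η = ξ
    · subst h
      rw [spherePoint_self, Real.dist_eq]
      exact abs_le.2 ⟨by linarith, by linarith⟩
    · rw [spherePoint_of_ne c r h, Real.dist_eq]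
      have h1 := hf.1 ξ η (Ne.symm h)
      refine abs_le.2 ⟨?_, by linarith⟩
      -- The upper bound for `f η` comes from a point `ζ` where its inequality is an equality.
      obtain ⟨ζ, hζ, h2⟩ := hf.2 η
      by_cases hζξ : ζ = ξ
      · subst hζξ
        have := hc ζ η
        linarith
      · have h3 := hf.1 ξ ζ (Ne.symm hζξ)
        have := hc0 η ζ
        have := hcr ξ ζ
        have := hcr ξ η
        linarith
  · have := dist_le_pi_dist (spherePoint c r ξ) f ξ
    rw [spherePoint_self, Real.dist_eq] at this
    have := neg_le_abs (-r - f ξ)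
    linarith

/-! ### Logarithmic coordinates on the Moebius space -/

/-- `log ρ²`. On the diagonal, where `ρ` vanishes, this is the junk value `0`. -/
noncomputable def logSq {Z : Type*} (ρ : Z → Z → ℝ) (ξ η : Z) : ℝ := 2 * Real.log (ρ ξ η)

/-- The coordinates `-log (dρ/dρ₀)` of a point `ρ` of the Moebius space of `ρ₀`. -/
noncomputable def MoebiusSpace.coord {Z : Type*} [Fintype Z] {ρ₀ : Z → Z → ℝ}
    (ρ : MoebiusSpace ρ₀) : Z → ℝ :=
  fun ξ => -Real.log (moebiusDeriv ρ.1.1 ρ₀ ξ)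

theorem IsAntipodalFunction.le_one {Z : Type*} [Fintype Z] {ρ : Z → Z → ℝ}
    (h : IsAntipodalFunction ρ) (ξ η : Z) : ρ ξ η ≤ 1 :=
  h.diam_one.1 ⟨(ξ, η), rfl⟩

theorem IsAntipodalFunction.ne_of_eq_one {Z : Type*} [Fintype Z] {ρ : Z → Z → ℝ}
    (h : IsAntipodalFunction ρ) {ξ η : Z} (h1 : ρ ξ η = 1) : η ≠ ξ := by
  rintro rfl
  rw [(h.separating.eq_zero_iff η η).2 rfl] at h1
  exact zero_ne_one h1

theorem logSq_nonpos {Z : Type*} [Fintype Z] {ρ : Z → Z → ℝ} (h : IsAntipodalFunction ρ)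
    (ξ η : Z) : logSq ρ ξ η ≤ 0 := by
  have := Real.log_nonpos (h.separating.nonneg ξ η) (h.le_one ξ η)
  rw [logSq]
  linarith

theorem logSq_comm {Z : Type*} [Fintype Z] {ρ : Z → Z → ℝ} (h : IsSeparating ρ) (ξ η : Z) :
    logSq ρ ξ η = logSq ρ η ξ := by
  rw [logSq, logSq, h.symm]

theorem IsMoebiusDerivative.logSq_eq {Z : Type*} [Fintype Z] {ρ₀ ρ₁ : Z → Z → ℝ} {φ : Z → ℝ}
    (h : IsMoebiusDerivative ρ₁ ρ₀ φ) (h₀ : IsSeparating ρ₀) {ξ η : Z} (hne : ξ ≠ η) :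
    logSq ρ₁ ξ η = Real.log (φ ξ) + Real.log (φ η) + logSq ρ₀ ξ η := by
  have h1 := congrArg Real.log (h.2 ξ η)
  rw [Real.log_mul (mul_pos (h.1 ξ) (h.1 η)).ne' (pow_ne_zero 2 (h₀.pos hne).ne'),
    Real.log_mul (h.1 ξ).ne' (h.1 η).ne', Real.log_pow, Real.log_pow] at h1
  exact_mod_cast h1

theorem MoebiusSpace.deriv_base {Z : Type*} [Fintype Z] {ρ₀ : Z → Z → ℝ}
    (h₀ : IsSeparating ρ₀) (ρ : MoebiusSpace ρ₀) :
    IsMoebiusDerivative ρ.1.1 ρ₀ (moebiusDeriv ρ.1.1 ρ₀) :=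
  moebiusDeriv_spec h₀ ρ.1.2.1 ρ.1.2.2

theorem MoebiusSpace.logSq_eq {Z : Type*} [Fintype Z] {ρ₀ : Z → Z → ℝ}
    (h₀ : IsSeparating ρ₀) (ρ : MoebiusSpace ρ₀) {ξ η : Z} (hne : ξ ≠ η) :
    logSq ρ.1.1 ξ η = logSq ρ₀ ξ η - (ρ.coord ξ + ρ.coord η) := by
  rw [(ρ.deriv_base h₀).logSq_eq h₀ hne, coord, coord]
  ring

theorem MoebiusSpace.coord_mem {Z : Type*} [Fintype Z] {ρ₀ : Z → Z → ℝ}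
    (h₀ : IsSeparating ρ₀) (ρ : MoebiusSpace ρ₀) : ρ.coord ∈ offDiagHull (logSq ρ₀) := by
  refine ⟨fun ξ η hne => ?_, fun ξ => ?_⟩
  · have h1 := ρ.logSq_eq h₀ hne
    have h2 := logSq_nonpos ρ.2 ξ η
    linarith
  · obtain ⟨η, hη⟩ := ρ.2.antipodal ξ
    have hne := ρ.2.ne_of_eq_one hη
    have h1 := ρ.logSq_eq h₀ hne.symm
    rw [logSq, hη, Real.log_one, mul_zero] at h1
    exact ⟨η, hne, by linarith⟩

theorem MoebiusSpace.isometry_coord {Z : Type*} [Fintype Z] {ρ₀ : Z → Z → ℝ}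
    (h₀ : IsSeparating ρ₀) : Isometry (MoebiusSpace.coord : MoebiusSpace ρ₀ → Z → ℝ) := by
  refine Isometry.of_dist_eq fun ρ₁ ρ₂ => ?_
  have h1 := ρ₁.deriv_base h₀
  have h2 := ρ₂.deriv_base h₀
  have h12 : moebiusDeriv ρ₂.1.1 ρ₁.1.1 =
      fun ξ => moebiusDeriv ρ₂.1.1 ρ₀ ξ / moebiusDeriv ρ₁.1.1 ρ₀ ξ := by
    refine moebiusDeriv_eq ρ₁.1.2.1 ⟨fun ξ => div_pos (h2.1 ξ) (h1.1 ξ), fun ξ η => ?_⟩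
    have p1 := h1.1 ξ
    have p2 := h1.1 η
    rw [h2.2, h1.2]
    field_simp
  rw [Subtype.dist_eq, UnrestrictedMoebiusSpace.dist_def, h12, dist_eq_norm]
  congr 1
  funext ξ
  rw [Real.log_div (h2.1 ξ).ne' (h1.1 ξ).ne', Pi.sub_apply, coord, coord]
  ring

theorem MoebiusSpace.coord_base {Z : Type*} [Fintype Z] {ρ₀ : Z → Z → ℝ}
    (h : IsAntipodalFunction ρ₀) : (MoebiusSpace.base h).coord = 0 := by
  have h1 : moebiusDeriv ρ₀ ρ₀ = fun _ => 1 :=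
    moebiusDeriv_eq h.separating ⟨fun _ => one_pos, fun _ _ => by ring⟩
  funext ξ
  show -Real.log (moebiusDeriv ρ₀ ρ₀ ξ) = 0
  rw [h1, Real.log_one, neg_zero]

theorem MoebiusSpace.exists_coord_eq {Z : Type*} [Fintype Z] {ρ₀ : Z → Z → ℝ}
    (h₀ : IsSeparating ρ₀) {f : Z → ℝ} (hf : f ∈ offDiagHull (logSq ρ₀)) :
    ∃ ρ : MoebiusSpace ρ₀, ρ.coord = f := by
  -- `e ^ 2 = exp (-f)` has to be the derivative.
  set e : Z → ℝ := fun ξ => Real.exp (-f ξ / 2) with he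
  have epos : ∀ ξ, 0 < e ξ := fun ξ => Real.exp_pos _
  have hloge : ∀ ξ, Real.log (e ξ) = -f ξ / 2 := fun ξ => Real.log_exp _
  set ρ : Z → Z → ℝ := fun ξ η => e ξ * e η * ρ₀ ξ η with hρ
  have hsep : IsSeparating ρ := by
    refine ⟨h₀.four_le_card, fun ξ η => ?_, fun ξ η => ?_, fun ξ η => ?_⟩
    · exact mul_nonneg (mul_pos (epos ξ) (epos η)).le (h₀.nonneg ξ η)
    · simp only [hρ]
      rw [h₀.symm ξ η, mul_comm (e ξ)]
    · rw [← h₀.eq_zero_iff ξ η]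
      simp only [hρ]
      rw [mul_eq_zero, or_iff_right (mul_pos (epos ξ) (epos η)).ne']
  have hder : IsMoebiusDerivative ρ ρ₀ fun ξ => e ξ ^ 2 :=
    ⟨fun ξ => pow_pos (epos ξ) 2, fun ξ η => by simp only [hρ]; ring⟩
  have hlog : ∀ ξ η, ξ ≠ η → 2 * Real.log (ρ ξ η) = logSq ρ₀ ξ η - (f ξ + f η) := by
    intro ξ η hne
    have := hder.logSq_eq h₀ hne
    simp only [Real.log_pow, hloge] at this
    rw [logSq] at this
    push_cast at this
    linarith
  have hequiv : MoebiusEquiv ρ₀ ρ := by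
    intro ξ ξ' η η' _ _ h1 h2 _ _
    have p1 := h₀.pos h1
    have p2 := h₀.pos h2
    have q1 := epos ξ
    have q2 := epos ξ'
    have q3 := epos η
    have q4 := epos η'
    simp only [crossRatio, hρ]
    field_simp
  have hle : ∀ ξ η, ρ ξ η ≤ 1 := fun ξ η => by
    by_cases hne : ξ = η
    · rw [(hsep.eq_zero_iff ξ η).2 hne]
      exact zero_le_one
    · have h1 := hlog ξ η hne
      have h2 := hf.1 ξ η hne
      exact (Real.log_nonpos_iff (hsep.nonneg ξ η)).1 (by linarith)
  have hanti : ∀ ξ, ∃ η, ρ ξ η = 1 := fun ξ => by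
    obtain ⟨η, hne, h1⟩ := hf.2 ξ
    have h2 := hlog ξ η hne.symm
    exact ⟨η, Real.eq_one_of_pos_of_log_eq_zero (hsep.pos hne.symm) (by linarith)⟩
  have hlub : IsLUB (Set.range fun p : Z × Z => ρ p.1 p.2) 1 := by
    have : Nonempty Z := Fintype.card_pos_iff.1 (by have := h₀.four_le_card; omega)
    obtain ⟨η, hη⟩ := hanti (Classical.arbitrary Z)
    refine ⟨?_, fun b hb => hb ⟨(_, η), hη⟩⟩
    rintro _ ⟨p, rfl⟩
    exact hle p.1 p.2
  refine ⟨⟨⟨ρ, hsep, hequiv⟩, hsep, hlub, hanti⟩, funext fun ξ => ?_⟩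
  show -Real.log (moebiusDeriv ρ ρ₀ ξ) = f ξ
  rw [moebiusDeriv_eq h₀ hder, Real.log_pow, hloge]
  push_cast
  ring

theorem IsSeparating.nontrivial {Z : Type*} [Fintype Z] {ρ : Z → Z → ℝ} (h : IsSeparating ρ) :
    Nontrivial Z :=
  Fintype.one_lt_card_iff_nontrivial.1 (by have := h.four_le_card; omega)

/-! ### Injectivity of balls -/

theorem MoebiusSpace.isInjectiveMetricSpace_closedBall {Z : Type u} [Fintype Z]
    {ρ₀ : Z → Z → ℝ} (h₀ : IsSeparating ρ₀) (ρ : MoebiusSpace ρ₀) {r : ℝ} (hr : 0 ≤ r) :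
    IsInjectiveMetricSpace.{u, v} (Metric.closedBall ρ r) := by
  intro A _ B f hf
  have := h₀.nontrivial
  have hiso := MoebiusSpace.isometry_coord h₀
  obtain ⟨F, hF1, hF2, hF3⟩ := exists_lipschitz_extension_mem_offDiagHull (logSq_comm h₀)
    (ρ.coord_mem h₀) hr (f := fun b => (f b).1.coord)
    (by simpa [Function.comp_def] using (hiso.lipschitz.comp (LipschitzWith.subtype_val _)).comp hf)
    (fun b => (f b).1.coord_mem h₀)
    (fun b => by rw [hiso.dist_eq]; exact (f b).2)
  choose G hG using fun a => MoebiusSpace.exists_coord_eq h₀ (hF3 a).1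
  refine ⟨fun a => ⟨G a, ?_⟩, ?_, fun b => Subtype.ext (hiso.injective ?_)⟩
  · rw [Metric.mem_closedBall, ← hiso.dist_eq, hG]
    exact (hF3 a).2
  · refine LipschitzWith.of_dist_le_mul fun a a' => ?_
    rw [Subtype.dist_eq, ← hiso.dist_eq, hG, hG]
    exact hF1.dist_le_mul a a'
  · rw [hG, hF2]

/-! ### Large balls are tight spans of their spheres -/

theorem TightSpan.apply_nonneg {X : Type*} [MetricSpace X] (h : TightSpan X) (x : X) :
    0 ≤ h.1 x := by
  have := h.2.1 x x
  rw [dist_self] at this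
  linarith

/-- For a finite space with two points or more, the inequality of an extremal function at `x` is an
equality for some `y ≠ x`. If only the diagonal inequality were an equality, then `h x = 0` and
`h y > dist x y` for all other `y`, against the Lipschitz property. -/
theorem TightSpan.exists_add_eq_dist {X : Type*} [MetricSpace X] [Finite X] [Nontrivial X]
    (h : TightSpan X) (x : X) : ∃ y, y ≠ x ∧ h.1 x + h.1 y = dist x y := by
  classical
  have hΔ : h.1 ∈ offDiagDelta (fun x y : X => dist x y) := fun a b _ => h.2.1 a b
  obtain ⟨y, hy, hm⟩ := exists_eq_offDiagConj (fun x y : X => dist x y) h.1 x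
  set m := offDiagConj (fun x y : X => dist x y) h.1 x
  have hg : Function.update h.1 x (max m 0) ∈ tightSpanDelta X := by
    have key : ∀ b, b ≠ x → dist x b ≤ max m 0 + h.1 b := fun b hb => by
      have h1 := le_offDiagConj (fun x y : X => dist x y) h.1 hb
      have h2 := le_max_left m 0
      linarith
    intro a b
    by_cases ha : a = x
    · subst ha
      rw [Function.update_self]
      by_cases hb : b = a
      · subst hb
        rw [Function.update_self, dist_self]
        have := le_max_right m 0
        linarith
      · rw [Function.update_of_ne hb]
        exact key b hb
    · rw [Function.update_of_ne ha]
      by_cases hb : b = x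
      · subst hb
        rw [Function.update_self, dist_comm, add_comm]
        exact key a ha
      · rw [Function.update_of_ne hb]
        exact h.2.1 a b
  have hle : ∀ a, Function.update h.1 x (max m 0) a ≤ h.1 a := fun a => by
    by_cases ha : a = x
    · subst ha
      rw [Function.update_self]
      exact max_le (offDiagConj_le hΔ a) (h.apply_nonneg a)
    · rw [Function.update_of_ne ha]
  have hx := congrFun (h.2.2 _ hg hle) x
  rw [Function.update_self] at hx
  have h1 := h.le_add_dist y x
  rw [dist_comm y x] at h1
  refine ⟨y, hy, ?_⟩
  rcases le_total m 0 with h0 | h0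
  · rw [max_eq_right h0] at hx
    linarith [h.2.1 x y]
  · rw [max_eq_left h0] at hx
    linarith

theorem proposition4p5 {Z : Type u} [Fintype Z] (ρ₀ : Z → Z → ℝ)
    (hρ₀ : IsAntipodalFunction ρ₀) :
    (∀ (ρ : MoebiusSpace ρ₀) (r : ℝ), 0 ≤ r →
      IsInjectiveMetricSpace.{u, v} (Metric.closedBall ρ r)) ∧
    ∃ R : ℝ, 0 < R ∧ ∀ r : ℝ, R ≤ r →
      (Metric.sphere (MoebiusSpace.base hρ₀) r).Finite ∧
      (Metric.sphere (MoebiusSpace.base hρ₀) r).ncard = Fintype.card Z ∧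
      ∃ Φ : Metric.closedBall (MoebiusSpace.base hρ₀) r ≃ᵢ
          TightSpan (Metric.sphere (MoebiusSpace.base hρ₀) r),
        ∀ (ρ : Metric.closedBall (MoebiusSpace.base hρ₀) r)
          (x : Metric.sphere (MoebiusSpace.base hρ₀) r),
          (Φ ρ).1 x = dist (x : MoebiusSpace ρ₀) (ρ : MoebiusSpace ρ₀) := by
  have h₀ := hρ₀.separating
  refine ⟨fun ρ r hr => ρ.isInjectiveMetricSpace_closedBall h₀ hr, ?_⟩
  have := h₀.nontrivial
  have hc := logSq_comm h₀
  have hc0 := logSq_nonpos hρ₀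
  have hiso := MoebiusSpace.isometry_coord h₀
  obtain ⟨C, hC⟩ := (Set.finite_range fun p : Z × Z => -logSq ρ₀ p.1 p.2).bddAbove
  have hC' : ∀ ξ η, -logSq ρ₀ ξ η ≤ C := fun ξ η => hC ⟨(ξ, η), rfl⟩
  refine ⟨max C 0 + 1, by positivity, fun r hr => ?_⟩
  have hr0 : 0 < r := by linarith [le_max_right C 0]
  have hcr : ∀ ξ η, -r < logSq ρ₀ ξ η := fun ξ η => by linarith [hC' ξ η, le_max_left C 0]
  have hdist : ∀ ρ : MoebiusSpace ρ₀, dist ρ (MoebiusSpace.base hρ₀) = ‖ρ.coord‖ := fun ρ => by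
    rw [← hiso.dist_eq, MoebiusSpace.coord_base, dist_zero_right]
  choose v hv using fun ξ =>
    MoebiusSpace.exists_coord_eq h₀ (spherePoint_mem (r := r) hc hc0 hcr ξ)
  have hvinj : Function.Injective v := fun ξ η h =>
    spherePoint_injective hr0.le hcr (by rw [← hv, ← hv, h])
  have hvmem : ∀ ξ, v ξ ∈ Metric.sphere (MoebiusSpace.base hρ₀) r := fun ξ => by
    rw [Metric.mem_sphere, hdist, hv, norm_spherePoint hr0.le hc0 hcr]
  have hvsurj : ∀ ρ ∈ Metric.sphere (MoebiusSpace.base hρ₀) r, ∃ ξ, v ξ = ρ := fun ρ hρ => by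
    rw [Metric.mem_sphere, hdist] at hρ
    obtain ⟨ξ, hξ⟩ := eq_spherePoint_of_norm_eq hr0 hc hc0 hcr (ρ.coord_mem h₀) hρ
    exact ⟨ξ, hiso.injective (by rw [hv, hξ])⟩
  have hrange : Set.range v = Metric.sphere (MoebiusSpace.base hρ₀) r :=
    Set.Subset.antisymm (Set.range_subset_iff.2 hvmem) hvsurj
  have hfin : (Metric.sphere (MoebiusSpace.base hρ₀) r).Finite := hrange ▸ Set.finite_range v
  refine ⟨hfin, ?_, ?_⟩
  · rw [← hrange, ← Set.image_univ, Set.ncard_image_of_injective _ hvinj, Set.ncard_univ,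
      Nat.card_eq_fintype_card]
  -- The points of the sphere, indexed by `Z`.
  set S := Metric.sphere (MoebiusSpace.base hρ₀) r with hS
  let e : Z ≃ S := Equiv.ofBijective (fun ξ => ⟨v ξ, hvmem ξ⟩)
    ⟨fun ξ η h => hvinj (congrArg Subtype.val h), fun x => by
      obtain ⟨ξ, hξ⟩ := hvsurj x.1 x.2
      exact ⟨ξ, Subtype.ext hξ⟩⟩
  have hecoord : ∀ ξ, (e ξ).1.coord = spherePoint (logSq ρ₀) r ξ := hv
  have : Finite S := hfin
  have : Nontrivial S := e.symm.nontrivial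
  have hball : ∀ ρ ∈ Metric.closedBall (MoebiusSpace.base hρ₀) r, ∀ ξ,
      dist (e ξ).1 ρ = ρ.coord ξ + r := fun ρ hρ ξ => by
    rw [Metric.mem_closedBall, hdist] at hρ
    rw [← hiso.dist_eq, hecoord]
    exact dist_spherePoint hc hc0 hcr (ρ.coord_mem h₀) hρ ξ
  have hee : ∀ ξ η, ξ ≠ η → dist (e ξ) (e η) = logSq ρ₀ ξ η + 2 * r := fun ξ η hne => by
    rw [Subtype.dist_eq, hball _ (Metric.sphere_subset_closedBall (e η).2), hecoord,
      spherePoint_of_ne _ _ hne, hc η ξ]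
    ring
  have hmem : ∀ ρ : Metric.closedBall (MoebiusSpace.base hρ₀) r,
      (fun x : S => dist x.1 ρ.1) ∈ tightSpanDelta S ∧
      ∀ g ∈ tightSpanDelta S, (∀ x, g x ≤ dist x.1 ρ.1) → g = fun x : S => dist x.1 ρ.1 := by
    refine fun ρ => ⟨fun x y => ?_, fun g hg hle => funext fun x => ?_⟩
    · rw [Subtype.dist_eq]
      exact dist_triangle_right x.1 y.1 ρ.1
    obtain ⟨ξ, rfl⟩ := e.surjective x
    obtain ⟨η, hne, hη⟩ := (ρ.1.coord_mem h₀).2 ξ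
    have h1 := hg (e ξ) (e η)
    have h2 := hle (e η)
    rw [hee ξ η hne.symm] at h1
    rw [hball ρ.1 ρ.2] at h2
    refine le_antisymm (hle _) ?_
    rw [hball ρ.1 ρ.2]
    linarith
  let φ : Metric.closedBall (MoebiusSpace.base hρ₀) r → TightSpan S := fun ρ => ⟨_, hmem ρ⟩
  have hφ : ∀ ρ ξ, (φ ρ).1 (e ξ) = ρ.1.coord ξ + r := fun ρ ξ => hball ρ.1 ρ.2 ξ
  have hφiso : Isometry φ := by
    refine Isometry.of_dist_eq fun ρ₁ ρ₂ => ?_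
    have habs : ∀ ξ, |(φ ρ₁).1 (e ξ) - (φ ρ₂).1 (e ξ)| = dist (ρ₁.1.coord ξ) (ρ₂.1.coord ξ) :=
      fun ξ => by rw [hφ, hφ, add_sub_add_right_eq_sub, Real.dist_eq]
    rw [TightSpan.dist_def, Subtype.dist_eq, ← hiso.dist_eq]
    refine le_antisymm (ciSup_le fun x => ?_) ((dist_pi_le_iff ?_).2 fun ξ => ?_)
    · obtain ⟨ξ, rfl⟩ := e.surjective x
      rw [habs]
      exact dist_le_pi_dist _ _ ξ
    · exact Real.iSup_nonneg fun _ => abs_nonneg _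
    · rw [← habs]
      exact le_ciSup (TightSpan.bddAbove (φ ρ₁) (φ ρ₂)) (e ξ)
  have hφsurj : Function.Surjective φ := by
    intro h
    have hatt : ∀ ξ, ∃ η, η ≠ ξ ∧ h.1 (e ξ) + h.1 (e η) = logSq ρ₀ ξ η + 2 * r := fun ξ => by
      obtain ⟨y, hy, hxy⟩ := h.exists_add_eq_dist (e ξ)
      obtain ⟨η, rfl⟩ := e.surjective y
      have hne : η ≠ ξ := fun hne => hy (by rw [hne])
      exact ⟨η, hne, by rw [hxy, hee ξ η hne.symm]⟩
    obtain ⟨ρ, hρ⟩ := MoebiusSpace.exists_coord_eq h₀ (f := fun ξ => h.1 (e ξ) - r) <| by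
      refine ⟨fun ξ η hne => ?_, fun ξ => ?_⟩
      · have := h.2.1 (e ξ) (e η)
        rw [hee ξ η hne] at this
        linarith
      · obtain ⟨η, hne, hη⟩ := hatt ξ
        exact ⟨η, hne, by linarith⟩
    have hρr : ρ ∈ Metric.closedBall (MoebiusSpace.base hρ₀) r := by
      rw [Metric.mem_closedBall, hdist, hρ]
      refine (pi_norm_le_iff_of_nonneg hr0.le).2 fun ξ => ?_
      obtain ⟨η, -, hη⟩ := hatt ξ
      have h1 := h.apply_nonneg (e ξ)
      have h2 := h.apply_nonneg (e η)
      have h3 := hc0 ξ η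
      rw [Real.norm_eq_abs]
      exact abs_le.2 ⟨by linarith, by linarith⟩
    refine ⟨⟨ρ, hρr⟩, Subtype.ext (funext fun x => ?_)⟩
    obtain ⟨ξ, rfl⟩ := e.surjective x
    rw [hφ]
    show ρ.coord ξ + r = _
    rw [hρ]
    ring
  exact ⟨⟨Equiv.ofBijective φ ⟨hφiso.injective, hφsurj⟩, hφiso⟩, fun _ _ => rfl⟩
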